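/- For an integer $n\ge 1$ let $$X_n^*=\{2k: k\in\mathbb Z^3,\ -\tfrac n2\le k_1,k_2,k_3\le \tfrac n2\}\cup\{2k+1: k\in\mathbb Z^3,\ -\tfrac{n+1}2\le k_1,k_2,k_3\le\tfrac{n-1}2\},$$ where $2k+1=(2k_1+1,2k_2+1,2k_3+1)$, and let $$\Lambda_n^{\dagger *}=\{k\in\mathbb Z^3: -n\le k_\nu\pm k_\mu\le n,\ 1\le\nu<\mu\le 3\}$$ be the set of integer points of a closed rhombic dodecahedron. To $k\in\Lambda_n^{\dagger *}$ associate $j\in\mathbb Z^4$ by $j_1=2(-k_1+k_2+k_3)$, $j_2=2(k_1-k_2+k_3)$, $j_3=2(k_1+k_2-k_3)$, $j_4=2(-k_1-k_2-k_3)$; then $|j_\nu-j_\mu|\le 4n$ for all $\nu,\mu$. Put $\widetilde\mu_k^{(n)}=1$ if $|j_\nu-j_\mu|<4n$ for all $\nu,\mu$. Otherwise put $\widetilde\mu_k^{(n)}=1/\binom{p+q}{p}$ if $\frac{j}{4n}$ lies in the boundary stratum $B^{p,q}$ of the dodecahedron $\overline\Omega=\{t\in\mathbb R^4: t_1+t_2+t_3+t_4=0,\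 |t_\nu-t_\mu|\le 1\}$. Here, for nonempty disjoint $I,J\subset\{1,2,3,4\}$, $\Omega_{I,J}=\{t\in\overline\Omega: t_j=t_i-1 \text{ for all } i\in I, j\in J\}$, $B_{I,J}$ is the set of points of $\Omega_{I,J}$ that lie in no $\Omega_{I_1,J_1}$ (with $I_1,J_1$ nonempty and disjoint) with $|I_1|+|J_1|>|I|+|J|$, and $B^{p,q}$ is the union of all $B_{I,J}$ with $|I|=p$, $|J|=q$. Thus $\widetilde\mu_k^{(n)}$ is $\frac12$ in the interior of the faces, $\frac13$ in the interior of the edges, $\frac14$ on $B^{1,3}\cup B^{3,1}$ and $\frac16$ on $B^{2,2}$. Let $$\Phi_n^*(x)=\frac1{2n^3}\sum_{k\in\Lambda_n^{\dagger *}}\widetilde\mu_k^{(n)}e^{2\pi i\,k\cdot x},\qquad I_n^*f(x)=\sum_{k\in X_n^*}f(\tfrac{k}{2n})\,\Phi_n^*(x-\tfrac{k}{2n}),$$ and let $\|I_n^*\|_\infty$ denote the norm of the operator $I_n^*:C([-\frac12,\frac12]^3)\to C([-\frac12,\frac12]^3)$, where the space of continuous complex-valued functions on the cube carries the uniform norm.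 Then there is a constant $c$, independent of $n$, such that $$\|I_n^*\|_\infty\le c\,(\log n)^3\qquad\text{for all } n\ge 2.$$ -/

import Mathlib

/-! Trigonometric interpolation on the cube `[-1/2, 1/2]³` at the nodes `k / (2n)`, `k ∈ X_n^*`,
with frequencies in the rhombic dodecahedron. -/

namespace TrigInterp

/-- The closed cube `[-1/2, 1/2]³`. -/
abbrev Cube : Set (Fin 3 → ℝ) := Set.Icc (fun _ => -(1 / 2)) (fun _ => 1 / 2)

/-- `X_n^* = {2k : -n/2 ≤ k₁, k₂, k₃ ≤ n/2} ∪ {2k+1 : -(n+1)/2 ≤ k₁, k₂, k₃ ≤ (n-1)/2}`, that is,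
the integer points of `[-n, n]³` whose coordinates are all even or all odd
(see `mem_nodeSet`). -/
noncomputable def nodeSet (n : ℕ) : Finset (Fin 3 → ℤ) :=
  (Fintype.piFinset fun _ => Finset.Icc (-(n : ℤ)) n).filter
    fun j => (∀ i, Even (j i)) ∨ (∀ i, Odd (j i))

theorem mem_nodeSet (n : ℕ) (j : Fin 3 → ℤ) :
    j ∈ nodeSet n ↔
      (∃ k : Fin 3 → ℤ, (∀ i, j i = 2 * k i) ∧
        ∀ i, -((n : ℝ) / 2) ≤ k i ∧ (k i : ℝ) ≤ (n : ℝ) / 2) ∨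
      (∃ k : Fin 3 → ℤ, (∀ i, j i = 2 * k i + 1) ∧
        ∀ i, -(((n : ℝ) + 1) / 2) ≤ k i ∧ (k i : ℝ) ≤ ((n : ℝ) - 1) / 2) := by
  have hbox : j ∈ (Fintype.piFinset fun _ => Finset.Icc (-(n : ℤ)) n) ↔
      ∀ i, -(n : ℝ) ≤ j i ∧ (j i : ℝ) ≤ n := by
    simp only [Fintype.mem_piFinset, Finset.mem_Icc]
    exact forall_congr' fun i => and_congr (by exact_mod_cast Iff.rfl) (by exact_mod_cast Iff.rfl)
  rw [nodeSet, Finset.mem_filter, hbox, and_or_left]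
  refine or_congr ⟨?_, ?_⟩ ⟨?_, ?_⟩
  · rintro ⟨hb, he⟩
    choose k hk using fun i => (even_iff_two_dvd.1 (he i))
    refine ⟨k, hk, fun i => ?_⟩
    have := hb i
    rw [hk i] at this
    push_cast at this
    constructor <;> linarith [this.1, this.2]
  · rintro ⟨k, hk, hb⟩
    refine ⟨fun i => ?_, fun i => ?_⟩
    · rw [hk i]
      push_cast
      constructor <;> linarith [(hb i).1, (hb i).2]
    · rw [hk i]
      exact even_two_mul _
  · rintro ⟨hb, he⟩
    choose k hk using he
    refine ⟨k, hk, fun i => ?_⟩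
    have := hb i
    rw [hk i] at this
    push_cast at this
    constructor <;> linarith [this.1, this.2]
  · rintro ⟨k, hk, hb⟩
    refine ⟨fun i => ?_, fun i => ?_⟩
    · rw [hk i]
      push_cast
      constructor <;> linarith [(hb i).1, (hb i).2]
    · exact ⟨k i, hk i⟩

/-- The frequency set
`Λ_n^{†*} = {k ∈ ℤ³ : -n ≤ k_ν ± k_μ ≤ n, 1 ≤ ν < μ ≤ 3}`, the integer points of the closed
rhombic dodecahedron. The box `[-n, n]³` only serves to make it a `Finset` (see `mem_freqSet`). -/
noncomputable def freqSet (n : ℕ) : Finset (Fin 3 → ℤ) :=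
  (Fintype.piFinset fun _ => Finset.Icc (-(n : ℤ)) n).filter
    fun k => ∀ a b : Fin 3, a < b → |k a + k b| ≤ n ∧ |k a - k b| ≤ n

theorem mem_freqSet (n : ℕ) (k : Fin 3 → ℤ) :
    k ∈ freqSet n ↔ ∀ a b : Fin 3, a < b → |k a + k b| ≤ n ∧ |k a - k b| ≤ n := by
  rw [freqSet, Finset.mem_filter, and_iff_right_iff_imp]
  intro h
  have h01 := h 0 1 (by decide)
  have h02 := h 0 2 (by decide)
  simp only [abs_le] at h01 h02
  simp only [Fintype.mem_piFinset, Finset.mem_Icc]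
  intro i
  fin_cases i <;> simp <;> omega

/-- Homogeneous coordinates `j ∈ ℤ⁴`, `j₁ + j₂ + j₃ + j₄ = 0`, of an index `k ∈ ℤ³`. -/
def homIndex (k : Fin 3 → ℤ) : Fin 4 → ℤ :=
  ![2 * (-k 0 + k 1 + k 2), 2 * (k 0 - k 1 + k 2), 2 * (k 0 + k 1 - k 2), 2 * (-k 0 - k 1 - k 2)]

/-- The closed rhombic dodecahedron `{t : t₁ + t₂ + t₃ + t₄ = 0, -1 ≤ t_i - t_j ≤ 1}`
in homogeneous coordinates. -/
def dodecahedron : Set (Fin 4 → ℝ) :=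
  {t | ∑ i, t i = 0 ∧ ∀ i j, -1 ≤ t i - t j ∧ t i - t j ≤ 1}

/-- Pairs of nonempty disjoint subsets of `{1, 2, 3, 4}`. -/
def IsFacePair (I J : Finset (Fin 4)) : Prop :=
  I.Nonempty ∧ J.Nonempty ∧ Disjoint I J

/-- `Ω_{I,J}`: the closed face `{t : t_j = t_i - 1 for all i ∈ I, j ∈ J}` of the dodecahedron. -/
def closedFace (I J : Finset (Fin 4)) : Set (Fin 4 → ℝ) :=
  {t | t ∈ dodecahedron ∧ ∀ i ∈ I, ∀ j ∈ J, t j = t i - 1}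

/-- `B_{I,J}`: the points of `Ω_{I,J}` that lie in no `Ω_{I₁,J₁}` with
`|I| + |J| < |I₁| + |J₁|`. -/
def boundaryElement (I J : Finset (Fin 4)) : Set (Fin 4 → ℝ) :=
  {t | t ∈ closedFace I J ∧ ∀ I₁ J₁ : Finset (Fin 4), IsFacePair I₁ J₁ →
    I.card + J.card < I₁.card + J₁.card → t ∉ closedFace I₁ J₁}

/-- `B^{p,q}`: the union of all boundary elements `B_{I,J}` with `|I| = p` and `|J| = q`. -/
def boundaryStratum (p q : ℕ) : Set (Fin 4 → ℝ) :=
  {t | ∃ I J : Finset (Fin 4), IsFacePair I J ∧ I.card = p ∧ J.card = q ∧ t ∈ boundaryElement I J}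

/-- The point `j / (4n)`, where `j` is the homogeneous form of `k`. -/
noncomputable def homPoint (n : ℕ) (k : Fin 3 → ℤ) : Fin 4 → ℝ :=
  fun i => (homIndex k i : ℝ) / (4 * n)

open Classical in
/-- The weight of an index `k ∈ Λ_n^{†*}`: it is `1` in the interior of the dodecahedron and
`1 / binom(p + q, p)` on `B^{p,q}`. -/
noncomputable def weight (n : ℕ) (k : Fin 3 → ℤ) : ℝ :=
  if ∀ i j, homIndex k i - homIndex k j < 4 * (n : ℤ) then 1
  else if homPoint n k ∈ boundaryStratum 1 1 then 1 / 2
  else if homPoint n k ∈ boundaryStratum 1 2 ∪ boundaryStratum 2 1 then 1 / 3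
  else if homPoint n k ∈ boundaryStratum 1 3 ∪ boundaryStratum 3 1 then 1 / 4
  else if homPoint n k ∈ boundaryStratum 2 2 then 1 / 6
  else 0

/-- The exponential `e_k(x) = exp(2πi k·x)`. -/
noncomputable def expo (k : Fin 3 → ℤ) (x : Fin 3 → ℝ) : ℂ :=
  Complex.exp (2 * Real.pi * Complex.I * ((∑ i, (k i : ℝ) * x i : ℝ) : ℂ))

/-- `Φ_n^*(x) = (1 / (2n³)) ∑_{ν ∈ Λ_n^{†*}} μ_ν e_ν(x)`. -/
noncomputable def kernelStar (n : ℕ) (x : Fin 3 → ℝ) : ℂ :=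
  1 / (2 * (n : ℂ) ^ 3) * ∑ k ∈ freqSet n, (weight n k : ℂ) * expo k x

theorem continuous_kernelStar (n : ℕ) : Continuous (kernelStar n) := by
  unfold kernelStar expo
  fun_prop

/-- The point `k / (2n)`. -/
noncomputable def nodePoint (n : ℕ) (k : Fin 3 → ℤ) : Fin 3 → ℝ :=
  fun i => (k i : ℝ) / (2 * n)

theorem nodePoint_mem_cube {n : ℕ} {k : Fin 3 → ℤ} (hk : k ∈ nodeSet n) :
    nodePoint n k ∈ Cube := by
  have hb := fun i => Finset.mem_Icc.1 (Fintype.mem_piFinset.1 (Finset.mem_filter.1 hk).1 i)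
  have hb' : ∀ i, -(n : ℝ) ≤ k i ∧ (k i : ℝ) ≤ n := fun i =>
    ⟨by exact_mod_cast (hb i).1, by exact_mod_cast (hb i).2⟩
  rcases Nat.eq_zero_or_pos n with rfl | hn
  · constructor <;> intro i <;> simp [nodePoint]
  · have hn' : (0 : ℝ) < 2 * n := by positivity
    constructor <;> intro i
    · simp only [nodePoint]
      rw [le_div_iff₀ hn']
      linarith [(hb' i).1]
    · simp only [nodePoint]
      rw [div_le_iff₀ hn']
      linarith [(hb' i).2]

/-- `R_k(x) = Φ_n^*(x - k / (2n))`, as a continuous function on the cube. -/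
noncomputable def cardinalFn (n : ℕ) (k : Fin 3 → ℤ) : C(Cube, ℂ) where
  toFun x := kernelStar n ((x : Fin 3 → ℝ) - nodePoint n k)
  continuous_toFun := (continuous_kernelStar n).comp (by fun_prop)

/-- The interpolation operator `I_n^* f = ∑_{k ∈ X_n^*} f(k / (2n)) R_k`
on `C([-1/2, 1/2]³)` with the uniform norm. -/
noncomputable def interpStar (n : ℕ) : C(Cube, ℂ) →L[ℂ] C(Cube, ℂ) :=
  ∑ k ∈ (nodeSet n).attach,
    (ContinuousMap.evalCLM ℂ (⟨nodePoint n k, nodePoint_mem_cube k.2⟩ : Cube)).smulRight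
      (cardinalFn n k)

theorem interpStar_apply (n : ℕ) (f : C(Cube, ℂ)) (x : Cube) :
    interpStar n f x = ∑ k ∈ (nodeSet n).attach,
      f ⟨nodePoint n k, nodePoint_mem_cube k.2⟩ *
        kernelStar n ((x : Fin 3 → ℝ) - nodePoint n k) := by
  simp [interpStar, cardinalFn, ContinuousMap.evalCLM]

end TrigInterp

namespace TrigInterp

open Finset

/-! The operator norm is at most the supremum over `x` of the sum of `‖kernelStar n (x - nodePoint n
k)‖` over the nodes `k`. A frequency is encoded by a vector `m` in `[0, n]⁴` with smallest entry `0`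
and even sum. Classify `m` by whether each entry is `0`, `n` or strictly between. The weight is
constant on each of the 81 classes (`weight_eq_of_pattern_eq`), so its values matter only through
`|weight| ≤ 1`. Apart from parity, a class is a box with one side equal to `{0}`. Its exponential
sum therefore factors, and at most three factors are nontrivial (`norm_sum_pattern_le`).

Three of the four homogeneous coordinates determine a node, so the sum over nodes is dominated by
products of three one-dimensional sums, each `O(n log n)` (`sum_dirichletMajorant_le`). The factor
`n³` cancels against the normalisation and `(log n)³` remains. -/

/-! ### One-dimensional exponential sums and their sums over equispaced points. -/

theorem fourierChar_intCast_mul_add_int (m a : ℤ) (t : ℝ) :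
    (Real.fourierChar (m * (t + a)) : ℂ) = Real.fourierChar (m * t) := by
  rw [Real.fourierChar_apply, Real.fourierChar_apply, Complex.exp_eq_exp_iff_exists_int]
  exact ⟨m * a, by push_cast; ring⟩

/-- `1 + |∑_{0 < m < n} e(m t)|`, a majorant of the one-dimensional exponential sums. -/
noncomputable def dirichletMajorant (n : ℕ) (t : ℝ) : ℝ :=
  1 + ‖∑ m ∈ Ioo (0 : ℤ) n, (Real.fourierChar (m * t) : ℂ)‖

theorem one_le_dirichletMajorant (n : ℕ) (t : ℝ) : 1 ≤ dirichletMajorant n t :=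
  le_add_of_nonneg_right (norm_nonneg _)

theorem dirichletMajorant_nonneg (n : ℕ) (t : ℝ) : 0 ≤ dirichletMajorant n t :=
  zero_le_one.trans (one_le_dirichletMajorant n t)

theorem dirichletMajorant_add_int (n : ℕ) (t : ℝ) (a : ℤ) :
    dirichletMajorant n (t + a) = dirichletMajorant n t := by
  simp only [dirichletMajorant, fourierChar_intCast_mul_add_int]

theorem dirichletMajorant_le_add_nat (n : ℕ) (t : ℝ) : dirichletMajorant n t ≤ 1 + n := by
  refine add_le_add le_rfl ((norm_sum_le _ _).trans ?_)
  simp only [Circle.norm_coe, sum_const, Int.card_Ioo, nsmul_eq_mul, mul_one]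
  exact_mod_cast (by omega : ((n : ℤ) - 0 - 1).toNat ≤ n)

theorem sum_Ioo_int_sub {f : ℤ → ℂ} (n : ℕ) (hn : 1 ≤ n) :
    ∑ m ∈ Ioo (0 : ℤ) n, (f (m + 1) - f m) = f n - f 1 := by
  induction n, hn using Nat.le_induction with
  | base => simp [show Ioo (0 : ℤ) 1 = ∅ from rfl]
  | succ n hn ih =>
    have : Ioo (0 : ℤ) ((n + 1 : ℕ) : ℤ) = insert (n : ℤ) (Ioo (0 : ℤ) n) := by
      ext m; simp only [mem_Ioo, mem_insert]; omega
    rw [this, sum_insert (by simp), ih]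
    push_cast
    ring

/-- Multiplying the geometric sum by `e(t) - 1` telescopes it to a difference of two unimodular
numbers, and `|e(t) - 1| = 2 |sin πt| ≥ 4 |t|` for `|t| ≤ 1/2`. -/
theorem dirichletMajorant_le_of_abs_le (n : ℕ) {t : ℝ} (ht0 : 0 < |t|) (ht : |t| ≤ 1 / 2) :
    dirichletMajorant n t ≤ 1 + 1 / (2 * |t|) := by
  refine add_le_add le_rfl ?_
  rcases Nat.eq_zero_or_pos n with rfl | hn
  · simp
  set S := ∑ m ∈ Ioo (0 : ℤ) n, (Real.fourierChar (m * t) : ℂ)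
  have hS : ((Real.fourierChar t : ℂ) - 1) * S =
      Real.fourierChar ((n : ℤ) * t) - Real.fourierChar ((1 : ℤ) * t) := by
    rw [← sum_Ioo_int_sub (f := fun m => (Real.fourierChar (m * t) : ℂ)) n hn, mul_sum]
    refine sum_congr rfl fun m _ => ?_
    rw [show ((m + 1 : ℤ) : ℝ) * t = t + m * t by push_cast; ring, AddChar.map_add_eq_mul,
      Circle.coe_mul]
    ring
  have h2 : ‖(Real.fourierChar t : ℂ) - 1‖ * ‖S‖ ≤ 2 := by
    rw [← norm_mul, hS]
    refine (norm_sub_le _ _).trans ?_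
    simp only [Circle.norm_coe]
    norm_num
  have h3 : 4 * |t| ≤ ‖(Real.fourierChar t : ℂ) - 1‖ := by
    rw [Real.fourierChar_apply, mul_comm _ Complex.I, Complex.norm_exp_I_mul_ofReal_sub_one]
    have := Real.mul_abs_le_abs_sin (x := 2 * Real.pi * t / 2) (by
      rw [show 2 * Real.pi * t / 2 = Real.pi * t by ring, abs_mul, abs_of_pos Real.pi_pos]
      nlinarith [Real.pi_pos])
    rw [show 2 * Real.pi * t / 2 = Real.pi * t by ring, abs_mul Real.pi,
      abs_of_pos Real.pi_pos, ← mul_assoc, div_mul_cancel₀ _ Real.pi_ne_zero] at this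
    rw [show 2 * Real.pi * t / 2 = Real.pi * t by ring, norm_mul]
    simp only [Real.norm_eq_abs, Nat.abs_ofNat]
    linarith
  rw [le_div_iff₀ (by positivity)]
  nlinarith [norm_nonneg S]

/-- Using `i + 1` in place of `i` lets the trivial bound cover `i = 0`, so that summing over `i`
gives a harmonic sum. -/
theorem dirichletMajorant_le_div {n i : ℕ} (hn : 1 ≤ n) {t : ℝ} (hi : (i : ℝ) / (4 * n) ≤ |t|)
    (ht : |t| ≤ 1 / 2) : dirichletMajorant n t ≤ 1 + 4 * n * ((i : ℝ) + 1)⁻¹ := by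
  have hn' : (0 : ℝ) < n := by exact_mod_cast hn
  rcases Nat.eq_zero_or_pos i with rfl | hi0
  · refine (dirichletMajorant_le_add_nat n t).trans ?_
    simp
    linarith
  · have hi1 : (1 : ℝ) ≤ i := by exact_mod_cast hi0
    have h0 : 0 < (i : ℝ) / (4 * n) := by positivity
    refine (dirichletMajorant_le_of_abs_le n (h0.trans_le hi) ht).trans (add_le_add le_rfl ?_)
    have : 1 / (2 * |t|) ≤ 1 / (2 * ((i : ℝ) / (4 * n))) := by gcongr
    refine this.trans ?_
    rw [← div_eq_mul_inv, div_le_div_iff₀ (by positivity) (by positivity)]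
    field_simp
    nlinarith

theorem sum_range_add_eq_of_periodic {g : ℤ → ℝ} {N : ℕ} (hg : Function.Periodic g (N : ℤ))
    (a b : ℤ) : ∑ i ∈ range N, g (a + i) = ∑ i ∈ range N, g (b + i) := by
  have step : ∀ a : ℤ, ∑ i ∈ range N, g (a + 1 + i) = ∑ i ∈ range N, g (a + i) := fun a => by
    have h1 := sum_range_succ (fun i : ℕ => g (a + i)) N
    have h2 := sum_range_succ' (fun i : ℕ => g (a + i)) N
    have h3 : ∀ i : ℕ, g (a + 1 + i) = g (a + (i + 1 : ℕ)) := fun i => by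
      congr 1; push_cast; ring
    simp only [h3]
    have h4 := hg a
    simp only [Nat.cast_zero, add_zero] at h2
    linarith
  have key : ∀ a : ℤ, ∑ i ∈ range N, g (a + i) = ∑ i ∈ range N, g (0 + i) := fun a => by
    induction a using Int.induction_on with
    | zero => rfl
    | succ k ih => rw [step, ih]
    | pred k ih => rw [← ih, ← step, sub_add_cancel]
  rw [key a, key b]

theorem sum_dirichletMajorant_period_le {n : ℕ} (hn : 1 ≤ n) (y : ℝ) (a : ℤ) :
    ∑ i ∈ range (4 * n), dirichletMajorant n (y - ((a + i : ℤ) : ℝ) / (4 * n)) ≤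
      4 * n + 8 * n * (1 + Real.log (2 * n)) := by
  have hn' : (0 : ℝ) < n := by exact_mod_cast hn
  have hper : Function.Periodic (fun r : ℤ => dirichletMajorant n (y - (r : ℝ) / (4 * n)))
      ((4 * n : ℕ) : ℤ) := fun r => by
    dsimp only
    rw [← dirichletMajorant_add_int n _ 1]
    congr 1
    push_cast
    field_simp
    ring
  set q := ⌊y * (4 * n)⌋
  set θ := Int.fract (y * (4 * n))
  have hy : y = (q + θ) / (4 * n) := by
    rw [Int.floor_add_fract]; field_simp
  have hθ0 : 0 ≤ θ := Int.fract_nonneg _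
  have hθ1 : θ ≤ 1 := (Int.fract_lt_one _).le
  -- This window puts all arguments in `[-1/2, 1/2]`, with `2n` of them on each side of `0`. After
  -- reflecting the first half, the `i`-th argument on either side has modulus at least `i / (4n)`.
  rw [sum_range_add_eq_of_periodic hper a (q - 2 * n + 1), show 4 * n = 2 * n + 2 * n by ring,
    sum_range_add, ← sum_range_reflect]
  have hbd : ∑ i ∈ range (2 * n), (1 + 4 * (n : ℝ) * ((i : ℝ) + 1)⁻¹) ≤
      2 * n + 4 * n * (1 + Real.log (2 * n)) := by
    have h := harmonic_le_one_add_log (2 * n)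
    rw [sum_add_distrib, ← mul_sum]
    simp only [harmonic, Rat.cast_sum, Rat.cast_inv, Rat.cast_natCast] at h
    push_cast at h
    simp only [sum_const, card_range, nsmul_eq_mul, mul_one]
    push_cast
    gcongr
  refine (add_le_add (sum_le_sum fun i hi => ?_) (sum_le_sum fun i hi => ?_)).trans
    ((add_le_add hbd hbd).trans (by linarith))
  · have hi' : (i : ℝ) + 1 ≤ 2 * n := by exact_mod_cast Finset.mem_range.1 hi
    have hc : ((2 * n - 1 - i : ℕ) : ℝ) = 2 * n - 1 - i := by
      rw [Nat.sub_sub, Nat.cast_sub (by have := Finset.mem_range.1 hi; omega)]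
      push_cast
      ring
    have e : y - ((q - 2 * n + 1 + (2 * n - 1 - i : ℕ) : ℤ) : ℝ) / (4 * n) = (i + θ) / (4 * n) := by
      rw [hy, Int.cast_add, Int.cast_natCast, hc]
      push_cast
      field_simp
      ring
    rw [e]
    have ha : |(i + θ) / (4 * (n : ℝ))| = (i + θ) / (4 * n) := abs_of_nonneg (by positivity)
    refine dirichletMajorant_le_div hn ?_ ?_
    · rw [ha]; gcongr; linarith
    · rw [ha, div_le_div_iff₀ (by positivity) (by positivity)]; linarith
  · have hi' : (i : ℝ) + 1 ≤ 2 * n := by exact_mod_cast Finset.mem_range.1 hi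
    have e : y - ((q - 2 * n + 1 + (2 * n + i : ℕ) : ℤ) : ℝ) / (4 * n) =
        -((i + (1 - θ)) / (4 * n)) := by
      rw [hy]
      push_cast
      field_simp
      ring
    rw [e]
    have h1θ : 0 ≤ 1 - θ := by linarith
    have ha : |-((i + (1 - θ)) / (4 * (n : ℝ)))| = (i + (1 - θ)) / (4 * n) := by
      rw [abs_neg]; exact abs_of_nonneg (by positivity)
    refine dirichletMajorant_le_div hn ?_ ?_
    · rw [ha]; gcongr; linarith
    · rw [ha, div_le_div_iff₀ (by positivity) (by positivity)]; linarith

theorem sum_dirichletMajorant_le {n : ℕ} (hn : 2 ≤ n) (y : ℝ) :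
    ∑ r ∈ Icc (-(3 * n : ℤ)) (3 * n), dirichletMajorant n (y - (r : ℝ) / (4 * n)) ≤
      68 * (n * Real.log n) := by
  have hn' : (0 : ℝ) < n := by exact_mod_cast (by omega : 0 < n)
  have hlog2 : Real.log 2 ≤ Real.log n :=
    Real.log_le_log (by norm_num) (by exact_mod_cast hn)
  have hinj : Set.InjOn (fun i : ℕ => (-(4 * n : ℤ)) + i) (range (8 * n)) :=
    fun i _ j _ h => by simpa using h
  have hsub : Icc (-(3 * n : ℤ)) (3 * n) ⊆ (range (8 * n)).image fun i : ℕ => (-(4 * n : ℤ)) + i := by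
    intro r hr
    rw [mem_Icc] at hr
    exact mem_image.2 ⟨(r + 4 * n).toNat, mem_range.2 (by omega), by omega⟩
  -- `[-3n, 3n]` lies inside the two full periods `[-4n, 4n)`.
  refine (sum_le_sum_of_subset_of_nonneg hsub fun _ _ _ => dirichletMajorant_nonneg _ _).trans ?_
  rw [sum_image hinj, show 8 * n = 4 * n + 4 * n by ring, sum_range_add]
  have h1 := sum_dirichletMajorant_period_le (by omega : 1 ≤ n) y (-(4 * n))
  have h2 := sum_dirichletMajorant_period_le (by omega : 1 ≤ n) y 0
  have h3 : ∀ i : ℕ, (-(4 * n : ℤ)) + (4 * n + i : ℕ) = 0 + i := fun i => by push_cast; ring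
  simp only [h3]
  refine (add_le_add h1 h2).trans ?_
  rw [Real.log_mul (by norm_num) hn'.ne']
  have := Real.log_two_gt_d9
  -- The total is `n (24 + 16 log 2 + 16 log n)`. As `log 2 ≤ log n` and `24 / log 2 < 35`, the
  -- constant `68` suffices.
  nlinarith

/-! ### Dependence of the weight on the active constraints. -/

theorem homIndex_sub_le {n : ℕ} {k : Fin 3 → ℤ} (hk : k ∈ freqSet n) (i j : Fin 4) :
    homIndex k i - homIndex k j ≤ 4 * n := by
  rw [mem_freqSet] at hk
  have h01 := hk 0 1 (by decide)
  have h02 := hk 0 2 (by decide)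
  have h12 := hk 1 2 (by decide)
  simp only [abs_le] at h01 h02 h12
  fin_cases i <;> fin_cases j <;> simp [homIndex] <;> omega

theorem homPoint_mem_closedFace {n : ℕ} (hn : 1 ≤ n) {k : Fin 3 → ℤ} (hk : k ∈ freqSet n)
    (I J : Finset (Fin 4)) :
    homPoint n k ∈ closedFace I J ↔
      ∀ i ∈ I, ∀ j ∈ J, homIndex k i - homIndex k j = 4 * n := by
  have hn' : (0 : ℝ) < 4 * n := by positivity
  have hle : ∀ i j, homPoint n k i - homPoint n k j ≤ 1 := fun i j => by
    rw [homPoint, homPoint, ← sub_div, div_le_one hn']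
    exact_mod_cast homIndex_sub_le hk i j
  have hmem : homPoint n k ∈ dodecahedron := by
    refine ⟨?_, fun i j => ⟨by linarith [hle j i], hle i j⟩⟩
    simp only [homPoint, ← sum_div, Fin.sum_univ_four, homIndex]
    simp
    left
    ring
  rw [closedFace, Set.mem_ofPred_eq, and_iff_right hmem]
  refine forall₂_congr fun i _ => forall₂_congr fun j _ => ?_
  rw [homPoint, homPoint, eq_sub_iff_add_eq, div_add_one hn'.ne', div_left_inj' hn'.ne']
  rw [sub_eq_iff_eq_add, eq_comm, add_comm]
  exact_mod_cast Iff.rfl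

/-- Strata are defined through membership in closed faces, which is decided by the pairs `(i, j)` at
which the difference attains `4n`. -/
theorem weight_congr {n : ℕ} (hn : 1 ≤ n) {k l : Fin 3 → ℤ} (hk : k ∈ freqSet n)
    (hl : l ∈ freqSet n)
    (h : ∀ i j, homIndex k i - homIndex k j = 4 * n ↔ homIndex l i - homIndex l j = 4 * n) :
    weight n k = weight n l := by
  have hface : ∀ I J, homPoint n k ∈ closedFace I J ↔ homPoint n l ∈ closedFace I J := fun I J => by
    simp only [homPoint_mem_closedFace hn hk, homPoint_mem_closedFace hn hl, h]
  have hstr : ∀ p q, homPoint n k ∈ boundaryStratum p q ↔ homPoint n l ∈ boundaryStratum p q :=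
    fun p q => by
      simp only [boundaryStratum, boundaryElement, Set.mem_ofPred_eq, hface]
  have hint : (∀ i j, homIndex k i - homIndex k j < 4 * (n : ℤ)) ↔
      ∀ i j, homIndex l i - homIndex l j < 4 * (n : ℤ) := by
    refine forall₂_congr fun i j => ?_
    rw [(homIndex_sub_le hk i j).lt_iff_ne, (homIndex_sub_le hl i j).lt_iff_ne, Ne, Ne, h]
  classical
  exact if_congr hint rfl <| if_congr (hstr 1 1) rfl <|
    if_congr (or_congr (hstr 1 2) (hstr 2 1)) rfl <|
    if_congr (or_congr (hstr 1 3) (hstr 3 1)) rfl <| if_congr (hstr 2 2) rfl rfl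

theorem abs_weight_le_one (n : ℕ) (k : Fin 3 → ℤ) : |weight n k| ≤ 1 := by
  unfold weight
  split_ifs <;> norm_num [abs_of_pos]

/-! ### Barycentric indexing of the frequencies. -/

/-- The frequency with barycentric index `m`: the `k` with
`homIndex k i - homIndex k j = 4 * (m i - m j)`, for `m` of even sum. -/
def freqOfIndex (m : Fin 4 → ℤ) : Fin 3 → ℤ :=
  ![(m 1 + m 2 - m 0 - m 3) / 2, (m 0 + m 2 - m 1 - m 3) / 2, (m 0 + m 1 - m 2 - m 3) / 2]

/-- Integer vectors in `[0, n]⁴` with even sum and smallest entry `0`. -/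
noncomputable def indexSet (n : ℕ) : Finset (Fin 4 → ℤ) :=
  (Fintype.piFinset fun _ => Icc (0 : ℤ) n).filter fun m => (∃ i, m i = 0) ∧ Even (∑ i, m i)

theorem mem_indexSet {n : ℕ} {m : Fin 4 → ℤ} :
    m ∈ indexSet n ↔ (∀ i, 0 ≤ m i ∧ m i ≤ n) ∧ (∃ i, m i = 0) ∧ Even (∑ i, m i) := by
  simp only [indexSet, mem_filter, Fintype.mem_piFinset, mem_Icc]

theorem homIndex_freqOfIndex_sub {m : Fin 4 → ℤ} (hm : Even (∑ i, m i)) (i j : Fin 4) :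
    homIndex (freqOfIndex m) i - homIndex (freqOfIndex m) j = 4 * (m i - m j) := by
  rw [Fin.sum_univ_four] at hm
  obtain ⟨c, hc⟩ := hm
  fin_cases i <;> fin_cases j <;> simp [homIndex, freqOfIndex] <;> omega

theorem freqOfIndex_mem {n : ℕ} {m : Fin 4 → ℤ} (hm : m ∈ indexSet n) :
    freqOfIndex m ∈ freqSet n := by
  rw [mem_indexSet, Fin.sum_univ_four] at hm
  obtain ⟨hb, -, c, hc⟩ := hm
  have h0 := hb 0
  have h1 := hb 1
  have h2 := hb 2
  have h3 := hb 3
  rw [mem_freqSet]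
  intro a b hab
  simp only [abs_le]
  fin_cases a <;> fin_cases b <;> simp at hab <;> simp [freqOfIndex] <;> omega

theorem freqOfIndex_injOn (n : ℕ) : Set.InjOn freqOfIndex (indexSet n : Set (Fin 4 → ℤ)) := by
  intro m hm l hl h
  rw [mem_coe, mem_indexSet] at hm hl
  obtain ⟨hmb, ⟨a, ha⟩, hme⟩ := hm
  obtain ⟨hlb, ⟨b, hb⟩, hle⟩ := hl
  have key : ∀ i j, m i - m j = l i - l j := fun i j => by
    have h1 := homIndex_freqOfIndex_sub hme i j
    have h2 := homIndex_freqOfIndex_sub hle i j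
    rw [h] at h1
    omega
  ext i
  have h1 := key a b
  have h2 := key i b
  have h3 := hmb b
  have h4 := hlb a
  omega

theorem exists_freqOfIndex_eq {n : ℕ} {k : Fin 3 → ℤ} (hk : k ∈ freqSet n) :
    ∃ m ∈ indexSet n, freqOfIndex m = k := by
  -- Subtracting the smallest homogeneous coordinate and dividing by `4` gives the index `m`.
  obtain ⟨i₀, hi₀⟩ := Finite.exists_min (homIndex k)
  have hdvd : ∀ i, (4 : ℤ) ∣ homIndex k i - homIndex k i₀ := fun i => by
    fin_cases i <;> fin_cases i₀ <;> simp [homIndex] <;> omega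
  choose m hm using hdvd
  have h0 := hm 0
  have h1 := hm 1
  have h2 := hm 2
  have h3 := hm 3
  simp only [homIndex, Matrix.cons_val] at h0 h1 h2 h3
  refine ⟨m, mem_indexSet.2 ⟨fun i => ?_, ⟨i₀, ?_⟩, ?_⟩, ?_⟩
  · have := hm i
    have := hi₀ i
    have := homIndex_sub_le hk i i₀
    omega
  · have := hm i₀
    omega
  · rw [Fin.sum_univ_four]
    -- The homogeneous coordinates sum to `0`, so `∑ m i = -homIndex k i₀`, which is even.
    have : 2 ∣ homIndex k i₀ := by fin_cases i₀ <;> simp [homIndex]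
    rw [Int.even_iff]
    omega
  · ext i
    fin_cases i <;> simp [freqOfIndex] <;> omega

theorem sum_freqSet {M : Type*} [AddCommMonoid M] (n : ℕ) (f : (Fin 3 → ℤ) → M) :
    ∑ k ∈ freqSet n, f k = ∑ m ∈ indexSet n, f (freqOfIndex m) := by
  symm
  refine sum_bij (fun m _ => freqOfIndex m) (fun m hm => freqOfIndex_mem hm)
    (fun m hm l hl h => freqOfIndex_injOn n hm hl h) (fun k hk => ?_) fun _ _ => rfl
  obtain ⟨m, hm, h⟩ := exists_freqOfIndex_eq hk
  exact ⟨m, hm, h⟩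

/-- Homogeneous coordinates of a point `x ∈ ℝ³`, dual to the indices of `freqOfIndex`. -/
noncomputable def homCoord (x : Fin 3 → ℝ) : Fin 4 → ℝ :=
  ![(-x 0 + x 1 + x 2) / 2, (x 0 - x 1 + x 2) / 2, (x 0 + x 1 - x 2) / 2, (-x 0 - x 1 - x 2) / 2]

theorem expo_freqOfIndex {m : Fin 4 → ℤ} (hm : Even (∑ i, m i)) (x : Fin 3 → ℝ) :
    expo (freqOfIndex m) x = ∏ i, (Real.fourierChar (m i * homCoord x i) : ℂ) := by
  rw [Fin.sum_univ_four] at hm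
  obtain ⟨c, hc⟩ := hm
  have e : ∑ i, (freqOfIndex m i : ℝ) * x i = ∑ i, m i * homCoord x i := by
    have h0 : freqOfIndex m 0 = c - m 0 - m 3 := by simp [freqOfIndex]; omega
    have h1 : freqOfIndex m 1 = c - m 1 - m 3 := by simp [freqOfIndex]; omega
    have h2 : freqOfIndex m 2 = c - m 2 - m 3 := by simp [freqOfIndex]; omega
    have hc' : (m 0 + m 1 + m 2 + m 3 : ℝ) = c + c := by exact_mod_cast hc
    rw [Fin.sum_univ_three, Fin.sum_univ_four, h0, h1, h2]
    simp only [homCoord, Matrix.cons_val]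
    push_cast
    linear_combination (-(x 0 + x 1 + x 2) / 2) * hc'
  have p : ∏ i, (Real.fourierChar (m i * homCoord x i) : ℂ) =
      Real.fourierChar (∑ i, m i * homCoord x i) := by
    simp only [Fin.prod_univ_four, Fin.sum_univ_four, AddChar.map_add_eq_mul, Circle.coe_mul]
  rw [p, ← e, expo, Real.fourierChar_apply]
  congr 1
  push_cast
  ring

/-! ### Splitting the kernel into boxes. -/

/-- A majorant of the exponential sums over boxes with at least one degenerate side. -/
noncomputable def boxMajorant (n : ℕ) (t : Fin 4 → ℝ) : ℝ :=
  ∑ j : Fin 4, ∏ a : Fin 3, dirichletMajorant n (t (j.succAbove a))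

theorem boxMajorant_nonneg (n : ℕ) (t : Fin 4 → ℝ) : 0 ≤ boxMajorant n t :=
  sum_nonneg fun _ _ => prod_nonneg fun _ _ => dirichletMajorant_nonneg _ _

/-- The parts `{0}`, `(0, n)` and `{n}` of `[0, n]`. -/
noncomputable def intervalPart (n : ℕ) : Fin 3 → Finset ℤ :=
  ![{0}, Ioo (0 : ℤ) n, {(n : ℤ)}]

/-- The index of the part of `[0, n]` in which each coordinate lies. -/
def pattern (n : ℕ) (m : Fin 4 → ℤ) : Fin 4 → Fin 3 :=
  fun i => if m i = 0 then 0 else if m i = n then 2 else 1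

theorem norm_sum_intervalPart_le (n : ℕ) (p : Fin 3) (t : ℝ) :
    ‖∑ m ∈ intervalPart n p, (Real.fourierChar (m * t) : ℂ)‖ ≤ dirichletMajorant n t := by
  have h := one_le_dirichletMajorant n t
  fin_cases p
  · simpa [intervalPart] using h
  · simp [intervalPart, dirichletMajorant]
  · simpa [intervalPart, Circle.norm_coe] using h

/-- The coordinate pinned at `0` contributes a factor of modulus `1`. This is why three logarithms
appear and not four. -/
theorem norm_prod_sum_intervalPart_le (n : ℕ) {P : Fin 4 → Fin 3} (hP : ∃ j, P j = 0)
    (t : Fin 4 → ℝ) :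
    ‖∏ i, ∑ m ∈ intervalPart n (P i), (Real.fourierChar (m * t i) : ℂ)‖ ≤ boxMajorant n t := by
  obtain ⟨j, hj⟩ := hP
  rw [Fin.prod_univ_succAbove _ j, hj, norm_mul, norm_prod]
  have h1 : ‖∑ m ∈ intervalPart n 0, (Real.fourierChar (m * t j) : ℂ)‖ = 1 := by
    simp [intervalPart]
  rw [h1, one_mul]
  refine (prod_le_prod (fun _ _ => norm_nonneg _) fun a _ =>
    norm_sum_intervalPart_le n _ (t (j.succAbove a))).trans ?_
  exact single_le_sum (f := fun j : Fin 4 => ∏ a : Fin 3, dirichletMajorant n (t (j.succAbove a)))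
    (fun _ _ => prod_nonneg fun _ _ => dirichletMajorant_nonneg _ _) (mem_univ j)

theorem ite_even_eq (s : ℤ) :
    (if Even s then (1 : ℂ) else 0) = 1 / 2 * (1 + Real.fourierChar ((s : ℝ) * (1 / 2))) := by
  rcases Int.even_or_odd s with h | h
  · rw [if_pos h]
    obtain ⟨c, rfl⟩ := h
    have h1 : (Real.fourierChar (((c + c : ℤ) : ℝ) * (1 / 2)) : ℂ) = 1 := by
      rw [Real.fourierChar_apply, Complex.exp_eq_one_iff]
      exact ⟨c, by push_cast; ring⟩
    rw [h1]; norm_num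
  · rw [if_neg (Int.not_even_iff_odd.2 h)]
    obtain ⟨c, rfl⟩ := h
    have h1 : (Real.fourierChar (((2 * c + 1 : ℤ) : ℝ) * (1 / 2)) : ℂ) = -1 := by
      rw [Real.fourierChar_apply, ← Complex.exp_pi_mul_I, Complex.exp_eq_exp_iff_exists_int]
      exact ⟨c, by push_cast; ring⟩
    rw [h1]; norm_num

/-- The indicator of even sum is the average of the trivial character and `(-1)^s`; the latter
shifts every `t i` by `1/2`. -/
theorem sum_even_piFinset (S : Fin 4 → Finset ℤ) (t : Fin 4 → ℝ) :
    ∑ m ∈ (Fintype.piFinset S).filter (fun m => Even (∑ i, m i)),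
        ∏ i, (Real.fourierChar (m i * t i) : ℂ) =
      1 / 2 * (∏ i, ∑ m ∈ S i, (Real.fourierChar (m * t i) : ℂ) +
        ∏ i, ∑ m ∈ S i, (Real.fourierChar (m * (t i + 1 / 2)) : ℂ)) := by
  rw [sum_filter, prod_univ_sum, prod_univ_sum, ← sum_add_distrib, mul_sum]
  refine sum_congr rfl fun m _ => ?_
  have h : (∏ i, (Real.fourierChar (m i * (t i + 1 / 2)) : ℂ)) =
      (∏ i, (Real.fourierChar (m i * t i) : ℂ)) *
        Real.fourierChar (((∑ i, m i : ℤ) : ℝ) * (1 / 2)) := by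
    simp only [Fin.prod_univ_four, Fin.sum_univ_four, Int.cast_add, mul_add, add_mul,
      AddChar.map_add_eq_mul, Circle.coe_mul]
    ring
  rw [h, ← one_mul (ite _ _ _), ← mul_one_add, mul_left_comm, ← ite_even_eq]
  simp

theorem intervalPart_pattern {n : ℕ} (hn : 1 ≤ n) {m : Fin 4 → ℤ} {P : Fin 4 → Fin 3} :
    ((∀ i, 0 ≤ m i ∧ m i ≤ n) ∧ pattern n m = P) ↔ ∀ i, m i ∈ intervalPart n (P i) := by
  rw [funext_iff, ← forall_and]
  refine forall_congr' fun i => ?_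
  generalize P i = p
  simp only [pattern]
  fin_cases p <;> simp [intervalPart] <;> split_ifs <;> simp <;> omega

/-- For entries in `[0, n]`, `m i - m j = n` forces `m i = n` and `m j = 0`, so the pattern
determines the active constraints. -/
theorem weight_eq_of_pattern_eq {n : ℕ} (hn : 1 ≤ n) {m l : Fin 4 → ℤ} (hm : m ∈ indexSet n)
    (hl : l ∈ indexSet n) (h : pattern n m = pattern n l) :
    weight n (freqOfIndex m) = weight n (freqOfIndex l) := by
  refine weight_congr hn (freqOfIndex_mem hm) (freqOfIndex_mem hl) fun i j => ?_
  rw [mem_indexSet] at hm hl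
  rw [homIndex_freqOfIndex_sub hm.2.2, homIndex_freqOfIndex_sub hl.2.2]
  have hi := congrFun h i
  have hj := congrFun h j
  have := hm.1 i
  have := hm.1 j
  have := hl.1 i
  have := hl.1 j
  simp only [pattern] at hi hj
  split_ifs at hi hj <;> omega

theorem norm_sum_pattern_le {n : ℕ} (hn : 1 ≤ n) (P : Fin 4 → Fin 3) (x : Fin 3 → ℝ) :
    ‖∑ m ∈ (indexSet n).filter (fun m => pattern n m = P),
        (weight n (freqOfIndex m) : ℂ) * expo (freqOfIndex m) x‖ ≤
      1 / 2 * (boxMajorant n (homCoord x) + boxMajorant n (fun i => homCoord x i + 1 / 2)) := by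
  have hB := add_nonneg (boxMajorant_nonneg n (homCoord x))
    (boxMajorant_nonneg n (fun i => homCoord x i + 1 / 2))
  rcases ((indexSet n).filter (fun m => pattern n m = P)).eq_empty_or_nonempty with he | ⟨l, hl⟩
  · rw [he, sum_empty, norm_zero]
    positivity
  rw [mem_filter] at hl
  obtain ⟨hl, hlP⟩ := hl
  obtain ⟨j, hj⟩ := (mem_indexSet.1 hl).2.1
  have hPj : ∃ j, P j = 0 := ⟨j, by rw [← hlP]; simp [pattern, hj]⟩
  -- Once some `P j` is `0`, the condition that an entry vanishes is automatic, leaving the even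
  -- points of a full box.
  have hset : (indexSet n).filter (fun m => pattern n m = P) =
      (Fintype.piFinset fun i => intervalPart n (P i)).filter fun m => Even (∑ i, m i) := by
    ext m
    rw [mem_filter, mem_indexSet, mem_filter, Fintype.mem_piFinset, ← intervalPart_pattern hn]
    refine ⟨fun h => ⟨⟨h.1.1, h.2⟩, h.1.2.2⟩, fun h => ⟨⟨h.1.1, ?_, h.2⟩, h.1.2⟩⟩
    obtain ⟨j, hj⟩ := hPj
    refine ⟨j, ?_⟩
    have hm := intervalPart_pattern hn |>.1 h.1 j
    simpa [hj, intervalPart] using hm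
  have hsum : ∑ m ∈ (indexSet n).filter (fun m => pattern n m = P),
      (weight n (freqOfIndex m) : ℂ) * expo (freqOfIndex m) x =
      (weight n (freqOfIndex l) : ℂ) * ∑ m ∈ (indexSet n).filter (fun m => pattern n m = P),
        ∏ i, (Real.fourierChar (m i * homCoord x i) : ℂ) := by
    rw [mul_sum]
    refine sum_congr rfl fun m hm => ?_
    rw [mem_filter] at hm
    rw [weight_eq_of_pattern_eq hn hm.1 hl (hm.2.trans hlP.symm),
      expo_freqOfIndex (mem_indexSet.1 hm.1).2.2]
  rw [hsum, hset, sum_even_piFinset, norm_mul, norm_mul, Complex.norm_real, Real.norm_eq_abs]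
  have h1 := norm_prod_sum_intervalPart_le n hPj (homCoord x)
  have h2 := norm_prod_sum_intervalPart_le n hPj (fun i => homCoord x i + 1 / 2)
  refine (mul_le_of_le_one_left (by positivity) (abs_weight_le_one _ _)).trans ?_
  rw [show ‖(1 / 2 : ℂ)‖ = 1 / 2 by norm_num]
  exact mul_le_mul_of_nonneg_left ((norm_add_le _ _).trans (add_le_add h1 h2)) (by norm_num)

theorem norm_kernelStar_le {n : ℕ} (hn : 1 ≤ n) (x : Fin 3 → ℝ) :
    ‖kernelStar n x‖ ≤ 81 / (4 * (n : ℝ) ^ 3) *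
      (boxMajorant n (homCoord x) + boxMajorant n (fun i => homCoord x i + 1 / 2)) := by
  rw [kernelStar, sum_freqSet, norm_mul, ← sum_fiberwise (indexSet n) (pattern n)]
  have h := (norm_sum_le univ fun P : Fin 4 → Fin 3 =>
    ∑ m ∈ (indexSet n).filter (fun m => pattern n m = P),
        (weight n (freqOfIndex m) : ℂ) * expo (freqOfIndex m) x).trans
    (sum_le_sum fun P _ => norm_sum_pattern_le hn P x)
  rw [sum_const, card_univ, Fintype.card_fun, Fintype.card_fin, Fintype.card_fin,
    nsmul_eq_mul] at h
  have h2 : ‖1 / (2 * (n : ℂ) ^ 3)‖ = 1 / (2 * (n : ℝ) ^ 3) := by simp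
  rw [h2]
  refine (mul_le_mul_of_nonneg_left h (by positivity)).trans (le_of_eq ?_)
  push_cast
  ring

/-! ### Summation over the nodes. -/

/-- The value `4n · homCoord (k / (2n))`. -/
def nodeIndex (k : Fin 3 → ℤ) : Fin 4 → ℤ :=
  ![-k 0 + k 1 + k 2, k 0 - k 1 + k 2, k 0 + k 1 - k 2, -k 0 - k 1 - k 2]

theorem homCoord_sub_nodePoint (n : ℕ) (x : Fin 3 → ℝ) (k : Fin 3 → ℤ) (i : Fin 4) :
    homCoord (x - nodePoint n k) i = homCoord x i - (nodeIndex k i : ℝ) / (4 * n) := by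
  rcases Nat.eq_zero_or_pos n with rfl | hn
  · fin_cases i <;> simp [homCoord, nodePoint]
  · have hn' : (n : ℝ) ≠ 0 := by positivity
    fin_cases i <;> simp [homCoord, nodePoint, nodeIndex] <;> field_simp <;> ring

/-- Any three of the four node indices determine `k`, and each has modulus at most `3n`. By
nonnegativity the sum can be enlarged to the full box, where it factors; the parity of the nodes
plays no role. -/
theorem sum_prod_dirichletMajorant_le {n : ℕ} (hn : 2 ≤ n) (y : Fin 4 → ℝ) (j : Fin 4) :
    ∑ k ∈ nodeSet n, ∏ a : Fin 3, dirichletMajorant n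
        (y (j.succAbove a) - (nodeIndex k (j.succAbove a) : ℝ) / (4 * n)) ≤
      (68 * (n * Real.log n)) ^ 3 := by
  have hinj : Set.InjOn (fun (k : Fin 3 → ℤ) (a : Fin 3) => nodeIndex k (j.succAbove a))
      (nodeSet n) := by
    intro k _ l _ h
    have h0 := congrFun h 0
    have h1 := congrFun h 1
    have h2 := congrFun h 2
    ext i
    fin_cases j <;> simp [nodeIndex, Fin.succAbove, Fin.lt_def] at h0 h1 h2 <;>
      fin_cases i <;> simp <;> omega
  have hsub : (nodeSet n).image (fun (k : Fin 3 → ℤ) (a : Fin 3) => nodeIndex k (j.succAbove a)) ⊆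
      Fintype.piFinset fun _ => Icc (-(3 * n : ℤ)) (3 * n) := by
    intro p hp
    obtain ⟨k, hk, rfl⟩ := mem_image.1 hp
    have hb := fun i => mem_Icc.1 (Fintype.mem_piFinset.1 (mem_filter.1 hk).1 i)
    have h0 := hb 0
    have h1 := hb 1
    have h2 := hb 2
    refine Fintype.mem_piFinset.2 fun a => mem_Icc.2 ?_
    generalize j.succAbove a = i
    fin_cases i <;> simp [nodeIndex] <;> omega
  rw [← sum_image (g := fun (k : Fin 3 → ℤ) (a : Fin 3) => nodeIndex k (j.succAbove a))
    (f := fun p : Fin 3 → ℤ => ∏ a, dirichletMajorant n (y (j.succAbove a) - (p a : ℝ) / (4 * n)))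
    hinj]
  refine (sum_le_sum_of_subset_of_nonneg hsub fun _ _ _ =>
    prod_nonneg fun _ _ => dirichletMajorant_nonneg _ _).trans ?_
  rw [← prod_univ_sum (fun _ => Icc (-(3 * n : ℤ)) (3 * n))
    (fun a r => dirichletMajorant n (y (j.succAbove a) - (r : ℝ) / (4 * n)))]
  refine (prod_le_prod (fun _ _ => sum_nonneg fun _ _ => dirichletMajorant_nonneg _ _)
    fun a _ => sum_dirichletMajorant_le hn (y (j.succAbove a))).trans ?_
  simp

theorem sum_boxMajorant_le {n : ℕ} (hn : 2 ≤ n) (y : Fin 4 → ℝ) :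
    ∑ k ∈ nodeSet n, boxMajorant n (fun i => y i - (nodeIndex k i : ℝ) / (4 * n)) ≤
      4 * (68 * (n * Real.log n)) ^ 3 := by
  simp only [boxMajorant]
  rw [sum_comm]
  refine (sum_le_sum fun j _ => sum_prod_dirichletMajorant_le hn y j).trans ?_
  simp

theorem sum_norm_kernelStar_le {n : ℕ} (hn : 2 ≤ n) (x : Fin 3 → ℝ) :
    ∑ k ∈ nodeSet n, ‖kernelStar n (x - nodePoint n k)‖ ≤
      162 * 68 ^ 3 * Real.log n ^ 3 := by
  have hn' : (0 : ℝ) < n := by exact_mod_cast (by omega : 0 < n)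
  refine (sum_le_sum fun k _ => norm_kernelStar_le (by omega : 1 ≤ n) _).trans ?_
  rw [← mul_sum, sum_add_distrib]
  have h1 := sum_boxMajorant_le hn (homCoord x)
  have h2 := sum_boxMajorant_le hn (fun i => homCoord x i + 1 / 2)
  have e1 : ∀ k, homCoord (x - nodePoint n k) =
      fun i => homCoord x i - (nodeIndex k i : ℝ) / (4 * n) := fun k =>
    funext fun i => homCoord_sub_nodePoint n x k i
  have e2 : ∀ k i, homCoord x i - (nodeIndex k i : ℝ) / (4 * n) + 1 / 2 =
      homCoord x i + 1 / 2 - (nodeIndex k i : ℝ) / (4 * n) := fun k i => by ring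
  simp only [e1, e2]
  refine (mul_le_mul_of_nonneg_left (add_le_add h1 h2) (by positivity)).trans (le_of_eq ?_)
  field_simp
  ring

theorem norm_interpStar_le {n : ℕ} (hn : 2 ≤ n) :
    ‖interpStar n‖ ≤ 162 * 68 ^ 3 * Real.log n ^ 3 := by
  have hlog : 0 ≤ Real.log n := Real.log_natCast_nonneg n
  refine ContinuousLinearMap.opNorm_le_bound _ (by positivity) fun f => ?_
  rw [ContinuousMap.norm_le _ (by positivity)]
  intro x
  rw [interpStar_apply]
  calc _ ≤ ∑ k ∈ (nodeSet n).attach,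
        ‖f‖ * ‖kernelStar n ((x : Fin 3 → ℝ) - nodePoint n k)‖ :=
      norm_sum_le_of_le _ fun k _ => by
        rw [norm_mul]
        exact mul_le_mul_of_nonneg_right (f.norm_coe_le_norm _) (norm_nonneg _)
    _ = ‖f‖ * ∑ k ∈ nodeSet n, ‖kernelStar n ((x : Fin 3 → ℝ) - nodePoint n k)‖ := by
      rw [← mul_sum, sum_attach (nodeSet n)
        (fun k => ‖kernelStar n ((x : Fin 3 → ℝ) - nodePoint n k)‖)]
    _ ≤ _ := by
      rw [mul_comm]
      exact mul_le_mul_of_nonneg_right (sum_norm_kernelStar_le hn x) (norm_nonneg _)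

end TrigInterp

theorem mainTheorem5 :
    ∃ c : ℝ, ∀ n : ℕ, 2 ≤ n → ‖TrigInterp.interpStar n‖ ≤ c * Real.log n ^ 3 :=
  ⟨_, fun _ hn => TrigInterp.norm_interpStar_le hn⟩
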